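/- For $A,B,C,D\in\mathbb{C}$ let $S=S_{(A,B,C,D)}$ be the affine cubic surface with equation $x^2+y^2+z^2+xyz=Ax+By+Cz+D$, and let $\mathsf{Fam}$ be the family of all these surfaces. Let $\Gamma=\mathbb{Z}/2\mathbb{Z}\star\mathbb{Z}/2\mathbb{Z}\star\mathbb{Z}/2\mathbb{Z}$, with standard generators $s_x,s_y,s_z$ (one for each factor), act on the set $S(\mathbb{C})\subset\mathbb{C}^3$ of complex points of each $S\in\mathsf{Fam}$ by the Vieta involutions $$s_x(x,y,z)=(-x-yz+A,\,y,\,z),\quad s_y(x,y,z)=(x,\,-y-zx+B,\,z),\quad s_z(x,y,z)=(x,\,y,\,-z-xy+C).$$ Let $\mu$ be a probability measure on $\{s_x,s_y,s_z\}$ with $\mu(s_x)\mu(s_y)\mu(s_z)>0$. Theorem. Let $S_1,\dots,S_m$ be elements of $\mathsf{Fam}$, and let $\Gamma$ act diagonally on $M=S_1(\mathbb{C})\times\cdots\times S_m(\mathbb{C})$. If a Borel probability measure $\nu$ on $M$ is $\mu$-stationary, i.e. $\nu=\mu(s_x)(s_x)_*\nu+\mu(s_y)(s_y)_*\nu+\mu(s_z)(s_z)_*\nu$,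 then the support of $\nu$ is compact. -/

import Mathlib

open MeasureTheory
open scoped ENNReal

/-- The family of affine cubic surfaces `x² + y² + z² + xyz = Ax + By + Cz + D`; a member is
recorded by its complex parameters `(A, B, C, D)`. -/
structure Fam where
  A : ℂ
  B : ℂ
  C : ℂ
  D : ℂ

namespace Fam

/-- The set `S(ℂ) ⊆ ℂ³` of complex points of the surface `S`. -/
def points (S : Fam) : Set (ℂ × ℂ × ℂ) :=
  {p | p.1 ^ 2 + p.2.1 ^ 2 + p.2.2 ^ 2 + p.1 * p.2.1 * p.2.2
    = S.A * p.1 + S.B * p.2.1 + S.C * p.2.2 + S.D}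

/-- The Vieta involutions `s_x`, `s_y`, `s_z` (indices `0`, `1`, `2`), as polynomial maps
of `ℂ³`. -/
def vietaMap (S : Fam) : Fin 3 → ℂ × ℂ × ℂ → ℂ × ℂ × ℂ
  | 0, (x, y, z) => (-x - y * z + S.A, y, z)
  | 1, (x, y, z) => (x, -y - z * x + S.B, z)
  | 2, (x, y, z) => (x, y, -z - x * y + S.C)

theorem vietaMap_mem (S : Fam) (i : Fin 3) {p : ℂ × ℂ × ℂ} (hp : p ∈ S.points) :
    S.vietaMap i p ∈ S.points := by
  obtain ⟨x, y, z⟩ := p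
  simp only [points, Set.mem_ofPred_eq] at hp ⊢
  fin_cases i <;> simp only [vietaMap] <;> linear_combination hp

theorem vietaMap_vietaMap (S : Fam) (i : Fin 3) (p : ℂ × ℂ × ℂ) :
    S.vietaMap i (S.vietaMap i p) = p := by
  obtain ⟨x, y, z⟩ := p
  fin_cases i <;> simp only [vietaMap, Prod.mk.injEq, true_and, and_true] <;> ring

/-- The Vieta involutions as permutations of `S(ℂ)`. -/
def vieta (S : Fam) (i : Fin 3) : Equiv.Perm S.points :=
  Function.Involutive.toPerm (fun p => ⟨S.vietaMap i p.1, S.vietaMap_mem i p.2⟩)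
    fun p => Subtype.ext (S.vietaMap_vietaMap i p.1)

theorem vieta_mul_self (S : Fam) (i : Fin 3) : S.vieta i * S.vieta i = 1 :=
  Equiv.ext fun p => Subtype.ext (S.vietaMap_vietaMap i p.1)

end Fam

/-- The group `Γ`, the free product `ℤ/2ℤ ⋆ ℤ/2ℤ ⋆ ℤ/2ℤ`. -/
abbrev VietaGroup : Type := Monoid.CoprodI fun _ : Fin 3 => Multiplicative (ZMod 2)

/-- The three standard generators `s_x`, `s_y`, `s_z` of `Γ` (indices `0`, `1`, `2`). -/
def VietaGroup.gen (i : Fin 3) : VietaGroup :=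
  Monoid.CoprodI.of (M := fun _ : Fin 3 => Multiplicative (ZMod 2)) (i := i)
    (Multiplicative.ofAdd 1)

/-- The homomorphism from `ℤ/2ℤ` to a group that sends the generator to a given element `g`
with `g * g = 1`. -/
def homOfInvolution {G : Type*} [Group G] (g : G) (hg : g * g = 1) :
    Multiplicative (ZMod 2) →* G :=
  AddMonoidHom.toMultiplicativeLeft
    (ZMod.lift 2 ⟨zmultiplesHom (Additive G) (Additive.ofMul g), by
      rw [zmultiplesHom_apply, Nat.cast_ofNat, two_zsmul, ← ofMul_mul, hg, ofMul_one]⟩)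

namespace Fam

/-- The homomorphism `Γ → Perm S(ℂ)` sending the generators of `Γ` to the Vieta involutions. -/
def actionHom (S : Fam) : VietaGroup →* Equiv.Perm S.points :=
  Monoid.CoprodI.lift fun i => homOfInvolution (S.vieta i) (S.vieta_mul_self i)

/-- The action of `Γ` on `S(ℂ)`. On products of such sets, the componentwise (diagonal) action is
the one that comes with `Pi.mulAction`. -/
instance (S : Fam) : MulAction VietaGroup S.points := MulAction.compHom S.points S.actionHom

theorem gen_smul (S : Fam) (i : Fin 3) (p : S.points) :
    ((VietaGroup.gen i • p : S.points) : ℂ × ℂ × ℂ) = S.vietaMap i p := by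
  have h : S.actionHom (VietaGroup.gen i) = S.vieta i := by
    rw [actionHom, VietaGroup.gen, Monoid.CoprodI.lift_of]
    have h2 := ZMod.lift_coe 2 (A := Additive (Equiv.Perm S.points))
      ⟨zmultiplesHom _ (Additive.ofMul (S.vieta i)), by
        rw [zmultiplesHom_apply, Nat.cast_ofNat, two_zsmul, ← ofMul_mul, vieta_mul_self,
          ofMul_one]⟩ 1
    rw [Int.cast_one] at h2
    simpa [homOfInvolution] using congrArg Additive.toMul h2
  change ((S.actionHom (VietaGroup.gen i) p : S.points) : ℂ × ℂ × ℂ) = _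
  rw [h]
  rfl

end Fam

/-- The measure `ν` is `μ`-stationary: `∫ g_* ν dμ(g) = ν`, where `μ` is a discrete probability
measure on the group that acts. -/
def IsStationaryMeasure {G X : Type*} [MeasurableSpace X] [SMul G X] (μ : PMF G)
    (ν : Measure X) : Prop :=
  Measure.sum (fun g : G => μ g • ν.map (fun x => g • x)) = ν

/-! Fix one factor of the product. Near infinity its surface contains three disjoint cusps, the
`i`-th being dominated by coordinate `i`. For `j ≠ i` the involution `s_j` sends cusp `i` into cusp
`j` (`Fam.vietaMap_mem_cusp`), while `s_i` leaves cusp `i`, and the norm drops by at least 1 if it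
enters another cusp (`Fam.norm_vietaMap_le`). So each point leaves the cusps after finitely many
reductions.

Multiplying one factor `F i < 1` per reduction gives a bounded positive function, equal to 1 off the
cusps. For suitable `F` it is superharmonic, strictly so on the cusps. A stationary probability
measure has no room for strict inequality, so the cusps are null (`measure_eq_zero_of_pingPong`). By
stationarity their preimages under the generators are null too, and these sets cover the complement
of a ball (`Fam.exists_mem_cusp`). -/

open Classical in
/-- If `x` lies in `D i`, its weight of order `n + 1` is `F i` times the weight of order `n` of
`t i x`; the weight of a point outside all `D i` is `1`. -/
noncomputable def reductionWeight {ι X : Type*} [Fintype ι] (D : ι → Set X) (t : ι → X → X)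
    (F : ι → ℝ) : ℕ → X → ℝ
  | 0, _ => 1
  | n + 1, x => ∏ i, if x ∈ D i then F i * reductionWeight D t F n (t i x) else 1

/-! ### Weights counting reduction steps -/

section ReductionWeight

open Filter Topology

variable {ι X : Type*} [Fintype ι] {D : ι → Set X} {t : ι → X → X} {F : ι → ℝ}

theorem reductionWeight_nonneg (hF0 : ∀ i, 0 ≤ F i) (n : ℕ) (x : X) :
    0 ≤ reductionWeight D t F n x := by
  induction n generalizing x with
  | zero => exact zero_le_one
  | succ n ih =>
    refine Finset.prod_nonneg fun i _ => ?_
    split_ifs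
    exacts [mul_nonneg (hF0 i) (ih _), zero_le_one]

theorem reductionWeight_le_one (hF0 : ∀ i, 0 ≤ F i) (hF1 : ∀ i, F i ≤ 1) (n : ℕ) (x : X) :
    reductionWeight D t F n x ≤ 1 := by
  induction n generalizing x with
  | zero => exact le_rfl
  | succ n ih =>
    refine Finset.prod_le_one (fun i _ => ?_) fun i _ => ?_ <;> split_ifs
    exacts [mul_nonneg (hF0 i) (reductionWeight_nonneg hF0 _ _), zero_le_one,
      mul_le_one₀ (hF1 i) (reductionWeight_nonneg hF0 _ _) (ih _), le_rfl]

theorem reductionWeight_antitone (hF0 : ∀ i, 0 ≤ F i) (hF1 : ∀ i, F i ≤ 1) (x : X) :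
    Antitone fun n => reductionWeight D t F n x := by
  refine antitone_nat_of_succ_le fun n => ?_
  induction n generalizing x with
  | zero => exact reductionWeight_le_one hF0 hF1 1 x
  | succ n ih =>
    refine Finset.prod_le_prod (fun i _ => ?_) fun i _ => ?_ <;> split_ifs
    exacts [mul_nonneg (hF0 i) (reductionWeight_nonneg hF0 _ _), zero_le_one,
      mul_le_mul_of_nonneg_left (ih _) (hF0 i), le_rfl]

theorem measurable_reductionWeight [MeasurableSpace X] (hD : ∀ i, MeasurableSet (D i))
    (ht : ∀ i, Measurable (t i)) (n : ℕ) : Measurable (reductionWeight D t F n) := by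
  induction n with
  | zero => exact measurable_const
  | succ n ih =>
    exact Finset.measurable_prod _ fun i _ =>
      Measurable.ite (hD i) ((ih.comp (ht i)).const_mul _) measurable_const

theorem reductionWeight_succ_of_mem (hdisj : ∀ i j x, x ∈ D i → x ∈ D j → i = j) {i : ι} {x : X}
    (hx : x ∈ D i) (n : ℕ) :
    reductionWeight D t F (n + 1) x = F i * reductionWeight D t F n (t i x) := by
  classical
  rw [reductionWeight, Finset.prod_eq_single i, if_pos hx]
  · exact fun j _ hj => if_neg fun h => hj (hdisj j i x h hx)
  · simp

/-- A limit of the weights: a function with values in `(0, 1]` that equals `1` outside the sets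
`D i` and is multiplied by `F i` as one enters `D i` by `t i`. -/
theorem exists_reduction_function [MeasurableSpace X] (hD : ∀ i, MeasurableSet (D i))
    (ht : ∀ i, Measurable (t i)) (hF0 : ∀ i, 0 < F i) (hF1 : ∀ i, F i ≤ 1)
    (hdisj : ∀ i j x, x ∈ D i → x ∈ D j → i = j)
    (h : X → ℝ) (h0 : ∀ x, 0 ≤ h x)
    (hh : ∀ i j x, x ∈ D i → t i x ∈ D j → h (t i x) ≤ h x - 1) :
    ∃ f : X → ℝ, Measurable f ∧ (∀ x, 0 < f x) ∧ (∀ x, f x ≤ 1) ∧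
      (∀ x, (∀ i, x ∉ D i) → f x = 1) ∧ ∀ i, ∀ x ∈ D i, f x = F i * f (t i x) := by
  have hlim : ∀ x, Tendsto (fun n => reductionWeight D t F n x) atTop
      (𝓝 (⨅ n, reductionWeight D t F n x)) := fun x =>
    tendsto_atTop_ciInf (reductionWeight_antitone (fun i => (hF0 i).le) hF1 x)
      ⟨0, by rintro _ ⟨n, rfl⟩; exact reductionWeight_nonneg (fun i => (hF0 i).le) n x⟩
  set f : X → ℝ := fun x => ⨅ n, reductionWeight D t F n x with hf
  have hout : ∀ x, (∀ i, x ∉ D i) → f x = 1 := fun x hx => by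
    refine tendsto_nhds_unique (hlim x) (tendsto_const_nhds.congr fun n => ?_)
    cases n with
    | zero => rfl
    | succ n => exact (Finset.prod_eq_one fun i _ => if_neg (hx i)).symm
  have hin : ∀ i, ∀ x ∈ D i, f x = F i * f (t i x) := fun i x hx =>
    tendsto_nhds_unique ((tendsto_add_atTop_iff_nat 1).2 (hlim x))
      (((hlim (t i x)).const_mul (F i)).congr fun n =>
        (reductionWeight_succ_of_mem hdisj hx n).symm)
  -- `h` bounds the number of reductions, so the limit is a finite product of positive factors.
  have hpos : ∀ n : ℕ, ∀ x, h x < n → 0 < f x := by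
    intro n
    induction n with
    | zero => exact fun x hx => absurd (h0 x) (not_le.2 (by simpa using hx))
    | succ n ih =>
      intro x hx
      by_cases hxD : ∃ i, x ∈ D i
      · obtain ⟨i, hi⟩ := hxD
        rw [hin i x hi]
        refine mul_pos (hF0 i) ?_
        by_cases hyD : ∃ j, t i x ∈ D j
        · obtain ⟨j, hj⟩ := hyD
          have := hh i j x hi hj
          push_cast at hx
          exact ih _ (by linarith)
        · rw [hout _ (not_exists.1 hyD)]
          exact zero_lt_one
      · rw [hout _ (not_exists.1 hxD)]
        exact zero_lt_one
  refine ⟨f, measurable_of_tendsto_metrizable (measurable_reductionWeight hD ht)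
    (tendsto_pi_nhds.2 hlim), fun x => ?_, fun x => ?_, hout, hin⟩
  · obtain ⟨n, hn⟩ := exists_nat_gt (h x)
    exact hpos n x hn
  · exact le_of_tendsto (hlim x) (.of_forall fun n =>
      reductionWeight_le_one (fun i => (hF0 i).le) hF1 n x)

end ReductionWeight

/-! ### Superharmonicity and ping-pong -/

/-- With `F i = 1 - ε / w i`, each of the at least two indices `j ≠ i` saves exactly `ε`. Since `ε /
w i ≤ 1/3`, dividing by `F i` costs at most `3ε/2 < 2ε`. This is where three generators are needed.
-/
theorem exists_contraction_factors {ι : Type*} [Fintype ι] [DecidableEq ι]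
    (hcard : 3 ≤ Fintype.card ι)
    {w : ι → ℝ} (hw : ∀ i, 0 < w i) (hsum : ∑ i, w i = 1) :
    ∃ F : ι → ℝ, (∀ i, 0 < F i) ∧ (∀ i, F i ≤ 1) ∧
      ∀ i, w i / F i + ∑ j ∈ Finset.univ.erase i, w j * F j < 1 := by
  have : Nonempty ι := Fintype.card_pos_iff.1 (by omega)
  obtain ⟨k, hk⟩ := Finite.exists_min w
  set ε := w k / 3 with hε
  have hε0 : 0 < ε := by have := hw k; positivity
  have hεw : ∀ i, 3 * ε ≤ w i := fun i => by have := hk i; linarith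
  have hF : ∀ i, w i * (1 - ε / w i) = w i - ε := fun i => by
    have := (hw i).ne'
    field_simp
  have hF0 : ∀ i, 0 < 1 - ε / w i := fun i => by
    rw [sub_pos, div_lt_one (hw i)]
    linarith [hεw i]
  refine ⟨fun i => 1 - ε / w i, hF0, fun i => ?_, fun i => ?_⟩
  · have := div_pos hε0 (hw i)
    linarith
  · simp only [hF]
    have h1 : w i / (1 - ε / w i) ≤ w i + 3 / 2 * ε := by
      rw [div_le_iff₀ (hF0 i)]
      have h2 : ε * (ε / w i) ≤ ε * (1 / 3) :=
        mul_le_mul_of_nonneg_left (by rw [div_le_iff₀ (hw i)]; linarith [hεw i]) hε0.le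
      have h3 := hF i
      nlinarith
    have h2 : (2 : ℝ) ≤ ((Finset.univ.erase i).card : ℝ) := by
      rw [Finset.card_erase_of_mem (Finset.mem_univ i), Finset.card_univ]
      exact_mod_cast (by omega : 2 ≤ Fintype.card ι - 1)
    rw [Finset.sum_sub_distrib, Finset.sum_const, nsmul_eq_mul]
    have h3 := Finset.add_sum_erase Finset.univ w (Finset.mem_univ i)
    nlinarith

/-- Ping-pong criterion: a stationary measure of a random walk generated by at least three
involutions gives no mass to sets `D i` such that `t j` maps `D i` into `D j` for `i ≠ j`,
provided that leaving the sets by reduction takes finitely many steps. -/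
theorem measure_eq_zero_of_pingPong {ι X : Type*} [Fintype ι] [MeasurableSpace X]
    (hcard : 3 ≤ Fintype.card ι) {ν : Measure X} [IsProbabilityMeasure ν]
    {w : ι → NNReal} (hw : ∀ i, 0 < w i) (hsum : ∑ i, w i = 1)
    {t : ι → X → X} (ht : ∀ i, Measurable (t i)) (htt : ∀ i x, t i (t i x) = x)
    (hν : ν = ∑ i, w i • ν.map (t i))
    {D : ι → Set X} (hD : ∀ i, MeasurableSet (D i))
    (hdisj : ∀ i j x, x ∈ D i → x ∈ D j → i = j)
    (hmaps : ∀ i j x, x ∈ D i → i ≠ j → t j x ∈ D j)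
    (h : X → ℝ) (h0 : ∀ x, 0 ≤ h x)
    (hh : ∀ i j x, x ∈ D i → t i x ∈ D j → h (t i x) ≤ h x - 1) (i : ι) :
    ν (D i) = 0 := by
  classical
  have hsum' : ∑ i, (w i : ℝ) = 1 := by exact_mod_cast hsum
  obtain ⟨F, hF0, hF1, hF⟩ := exists_contraction_factors hcard
    (w := fun i => (w i : ℝ)) (fun i => by exact_mod_cast hw i) hsum'
  obtain ⟨f, hfm, hf0, hf1, hout, hin⟩ := exists_reduction_function hD ht hF0 hF1 hdisj h h0 hh
  have hint : ∀ g : X → X, Measurable g → Integrable (fun x => f (g x)) ν := fun g hg =>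
    Integrable.of_bound (hfm.comp hg).aestronglyMeasurable 1 (.of_forall fun x => by
      rw [Real.norm_eq_abs, abs_of_pos (hf0 _)]; exact hf1 _)
  -- For `j ≠ i` the point `t j x` lies in `D j` and reduces back to `x`, so `f` gains a factor `F
  -- j`; along `t i` it is divided by `F i`.
  have hlt : ∀ i, ∀ x ∈ D i, ∑ j, w j * f (t j x) < f x := by
    intro i x hx
    rw [← Finset.add_sum_erase _ _ (Finset.mem_univ i)]
    have h1 : f (t i x) = f x / F i := by
      rw [hin i x hx, mul_div_cancel_left₀ _ (hF0 i).ne']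
    have h2 : ∑ j ∈ Finset.univ.erase i, w j * f (t j x)
        = (∑ j ∈ Finset.univ.erase i, w j * F j) * f x := by
      rw [Finset.sum_mul]
      refine Finset.sum_congr rfl fun j hj => ?_
      rw [hin j _ (hmaps i j x hx (Finset.ne_of_mem_erase hj).symm), htt, mul_assoc]
    rw [h1, h2]
    calc w i * (f x / F i) + (∑ j ∈ Finset.univ.erase i, w j * F j) * f x
        = (w i / F i + ∑ j ∈ Finset.univ.erase i, w j * F j) * f x := by ring
      _ < 1 * f x := mul_lt_mul_of_pos_right (hF i) (hf0 x)
      _ = f x := one_mul _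
  -- Off the sets `D i`, `f` takes its maximal value 1.
  have hle : ∀ x, ∑ j, w j * f (t j x) ≤ f x := by
    intro x
    by_cases hx : ∃ i, x ∈ D i
    · exact (hlt _ x hx.choose_spec).le
    · rw [hout x (not_exists.1 hx), ← hsum']
      exact Finset.sum_le_sum fun j _ => mul_le_of_le_one_right (w j).2 (hf1 _)
  have hPint : Integrable (fun x => ∑ j, w j * f (t j x)) ν :=
    integrable_finsetSum _ fun j _ => (hint _ (ht j)).const_mul _
  have hPf : ∫ x, f x ∂ν = ∫ x, ∑ j, w j * f (t j x) ∂ν := by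
    rw [integral_finsetSum _ fun j _ => (hint _ (ht j)).const_mul _]
    conv_lhs => rw [hν]
    rw [integral_finsetSum_measure]
    · refine Finset.sum_congr rfl fun j _ => ?_
      rw [integral_smul_nnreal_measure, integral_map (ht j).aemeasurable
        hfm.aestronglyMeasurable, integral_const_mul]
      rfl
    · exact fun j _ => ((integrable_map_measure hfm.aestronglyMeasurable
        (ht j).aemeasurable).2 (hint _ (ht j))).smul_measure_nnreal
  have hzero : ∫ x, (f x - ∑ j, w j * f (t j x)) ∂ν = 0 := by
    rw [integral_sub (show Integrable f ν from hint id measurable_id) hPint, hPf, sub_self]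
  rw [integral_eq_zero_iff_of_nonneg (fun x => sub_nonneg.2 (hle x))
    ((hint id measurable_id).sub hPint)] at hzero
  refine measure_mono_null (fun x hx => ?_) (ae_iff.1 hzero)
  exact (sub_pos.2 (hlt i x hx)).ne'

/-! ### Geometry of the surface near infinity -/

namespace Fam

/-- The coordinates on `ℂ³`, indexed like the Vieta involutions. -/
def coord : Fin 3 → ℂ × ℂ × ℂ → ℂ
  | 0, p => p.1
  | 1, p => p.2.1
  | 2, p => p.2.2

/-- The linear coefficients of the equation. -/
def coeff (S : Fam) : Fin 3 → ℂ
  | 0 => S.A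
  | 1 => S.B
  | 2 => S.C

theorem norm_coord_le (i : Fin 3) (p : ℂ × ℂ × ℂ) : ‖coord i p‖ ≤ ‖p‖ := by
  obtain ⟨x, y, z⟩ := p
  fin_cases i <;> simp [coord, Prod.norm_def]

theorem norm_le_of_coord_le {p : ℂ × ℂ × ℂ} {r : ℝ} (h : ∀ i, ‖coord i p‖ ≤ r) : ‖p‖ ≤ r :=
  max_le (h 0) (max_le (h 1) (h 2))

theorem continuous_coord (i : Fin 3) : Continuous (coord i) := by
  fin_cases i
  exacts [continuous_fst, continuous_fst.comp continuous_snd, continuous_snd.comp continuous_snd]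

theorem continuous_vietaMap (S : Fam) (i : Fin 3) : Continuous (S.vietaMap i) := by
  fin_cases i
  · change Continuous fun p : ℂ × ℂ × ℂ => (-p.1 - p.2.1 * p.2.2 + S.A, p.2.1, p.2.2)
    fun_prop
  · change Continuous fun p : ℂ × ℂ × ℂ => (p.1, -p.2.1 - p.2.2 * p.1 + S.B, p.2.2)
    fun_prop
  · change Continuous fun p : ℂ × ℂ × ℂ => (p.1, p.2.1, -p.2.2 - p.1 * p.2.1 + S.C)
    fun_prop

theorem isClosed_points (S : Fam) : IsClosed S.points :=
  isClosed_eq (by fun_prop) (by fun_prop)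

theorem coord_vietaMap_self (S : Fam) (i : Fin 3) (p : ℂ × ℂ × ℂ) :
    coord i (S.vietaMap i p)
      = -coord i p - coord (i + 1) p * coord (i + 2) p + S.coeff i := by
  fin_cases i <;> rfl

theorem coord_vietaMap_of_ne (S : Fam) {i j : Fin 3} (h : j ≠ i) (p : ℂ × ℂ × ℂ) :
    coord j (S.vietaMap i p) = coord j p := by
  fin_cases i <;> fin_cases j <;> first | rfl | exact absurd rfl h

theorem mem_points_iff (S : Fam) (i : Fin 3) (p : ℂ × ℂ × ℂ) :
    p ∈ S.points ↔ coord i p ^ 2 + coord (i + 1) p ^ 2 + coord (i + 2) p ^ 2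
      + coord i p * coord (i + 1) p * coord (i + 2) p
      = S.coeff i * coord i p + S.coeff (i + 1) * coord (i + 1) p
        + S.coeff (i + 2) * coord (i + 2) p + S.D := by
  obtain ⟨x, y, z⟩ := p
  fin_cases i
  · exact Iff.rfl
  · change x ^ 2 + y ^ 2 + z ^ 2 + x * y * z = S.A * x + S.B * y + S.C * z + S.D ↔
      y ^ 2 + z ^ 2 + x ^ 2 + y * z * x = S.B * y + S.C * z + S.A * x + S.D
    constructor <;> intro h <;> linear_combination h
  · change x ^ 2 + y ^ 2 + z ^ 2 + x * y * z = S.A * x + S.B * y + S.C * z + S.D ↔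
      z ^ 2 + x ^ 2 + y ^ 2 + z * x * y = S.C * z + S.A * x + S.B * y + S.D
    constructor <;> intro h <;> linear_combination h

/-- A bound beyond which a coordinate counts as large. -/
noncomputable def bound (S : Fam) : ℝ := 10 + ‖S.A‖ + ‖S.B‖ + ‖S.C‖ + ‖S.D‖

theorem ten_le_bound (S : Fam) : 10 ≤ S.bound := by
  have := norm_nonneg S.A; have := norm_nonneg S.B
  have := norm_nonneg S.C; have := norm_nonneg S.D
  rw [bound]; linarith

theorem norm_coeff_le (S : Fam) (i : Fin 3) : ‖S.coeff i‖ ≤ S.bound := by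
  have := norm_nonneg S.A; have := norm_nonneg S.B
  have := norm_nonneg S.C; have := norm_nonneg S.D
  fin_cases i <;> simp only [coeff, bound] <;> linarith

theorem norm_D_le (S : Fam) : ‖S.D‖ ≤ S.bound := by
  have := norm_nonneg S.A; have := norm_nonneg S.B
  have := norm_nonneg S.C
  rw [bound]; linarith

/-- The region near infinity in which the `i`-th coordinate dominates. -/
def cusp (S : Fam) (i : Fin 3) : Set (ℂ × ℂ × ℂ) :=
  {p | S.bound ≤ ‖coord (i + 1) p‖ ∧ S.bound ≤ ‖coord (i + 2) p‖ ∧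
    ‖coord (i + 1) p‖ * ‖coord (i + 2) p‖ ≤ 3 * ‖coord i p‖}

theorem isClosed_cusp (S : Fam) (i : Fin 3) : IsClosed (S.cusp i) := by
  have h := fun j => (continuous_coord j).norm
  exact (isClosed_le continuous_const (h _)).inter ((isClosed_le continuous_const (h _)).inter
    (isClosed_le ((h _).mul (h _)) (continuous_const.mul (h _))))

theorem eq_add_one_or_eq_add_two {i j k : Fin 3} (hij : i ≠ j) (hjk : j ≠ k) (hik : i ≠ k) :
    (j = i + 1 ∧ k = i + 2) ∨ (k = i + 1 ∧ j = i + 2) := by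
  revert i j k; decide

/-- The definition of the cusps, in terms of an arbitrary enumeration of the indices. -/
theorem mem_cusp_iff (S : Fam) {i j k : Fin 3} (hij : i ≠ j) (hjk : j ≠ k) (hik : i ≠ k)
    (p : ℂ × ℂ × ℂ) :
    p ∈ S.cusp i ↔ S.bound ≤ ‖coord j p‖ ∧ S.bound ≤ ‖coord k p‖ ∧
      ‖coord j p‖ * ‖coord k p‖ ≤ 3 * ‖coord i p‖ := by
  rw [cusp, Set.mem_ofPred_eq]
  obtain ⟨rfl, rfl⟩ | ⟨rfl, rfl⟩ := eq_add_one_or_eq_add_two hij hjk hik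
  · rfl
  · rw [mul_comm ‖coord (i + 2) p‖]; tauto

theorem exists_third {i j : Fin 3} (h : i ≠ j) : ∃ k, j ≠ k ∧ i ≠ k := by
  revert i j; decide

theorem norm_coord_le_of_mem_cusp (S : Fam) {i j : Fin 3} (h : i ≠ j) {p : ℂ × ℂ × ℂ}
    (hp : p ∈ S.cusp i) : 10 * ‖coord j p‖ ≤ 3 * ‖coord i p‖ := by
  obtain ⟨k, hjk, hik⟩ := exists_third h
  obtain ⟨h1, h2, h3⟩ := (S.mem_cusp_iff h hjk hik p).1 hp
  have := S.ten_le_bound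
  nlinarith [norm_nonneg (coord j p)]

theorem bound_le_of_mem_cusp (S : Fam) {i : Fin 3} (j : Fin 3) {p : ℂ × ℂ × ℂ}
    (hp : p ∈ S.cusp i) : S.bound ≤ ‖coord j p‖ := by
  have hne : ∀ k, i ≠ k → S.bound ≤ ‖coord k p‖ := fun k hk => by
    obtain ⟨l, hkl, hil⟩ := exists_third hk
    exact ((S.mem_cusp_iff hk hkl hil p).1 hp).1
  by_cases h : i = j
  · subst h
    obtain ⟨k, hk⟩ := exists_ne i
    have := S.norm_coord_le_of_mem_cusp hk.symm hp
    linarith [hne k hk.symm, S.ten_le_bound]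
  · exact hne j h

theorem norm_eq_of_mem_cusp (S : Fam) {i : Fin 3} {p : ℂ × ℂ × ℂ} (hp : p ∈ S.cusp i) :
    ‖p‖ = ‖coord i p‖ := by
  refine le_antisymm (norm_le_of_coord_le fun j => ?_) (norm_coord_le i p)
  by_cases h : i = j
  · rw [h]
  · linarith [S.norm_coord_le_of_mem_cusp h hp, norm_nonneg (coord j p)]

theorem cusp_disjoint (S : Fam) (i j : Fin 3) (p : ℂ × ℂ × ℂ) (hi : p ∈ S.cusp i)
    (hj : p ∈ S.cusp j) : i = j := by
  by_contra h
  have h1 := S.norm_coord_le_of_mem_cusp h hi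
  have h2 := S.norm_coord_le_of_mem_cusp (Ne.symm h) hj
  linarith [S.bound_le_of_mem_cusp j hi, S.ten_le_bound]

/-- In the new `j`-th coordinate the product of the two others outweighs the old coordinate and the
linear coefficient. -/
theorem vietaMap_mem_cusp (S : Fam) (i j : Fin 3) (p : ℂ × ℂ × ℂ) (hp : p ∈ S.cusp i)
    (h : i ≠ j) : S.vietaMap j p ∈ S.cusp j := by
  obtain ⟨k, hjk, hik⟩ := exists_third h
  rw [S.mem_cusp_iff h.symm hik hjk, S.coord_vietaMap_of_ne h, S.coord_vietaMap_of_ne hjk.symm]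
  have hi := S.bound_le_of_mem_cusp i hp
  have hk := S.bound_le_of_mem_cusp k hp
  refine ⟨hi, hk, ?_⟩
  have hprod : coord (j + 1) p * coord (j + 2) p = coord i p * coord k p := by
    obtain ⟨rfl, rfl⟩ | ⟨rfl, rfl⟩ :=
      eq_add_one_or_eq_add_two h.symm hik hjk
    · rfl
    · exact mul_comm _ _
  have hc := S.norm_coeff_le j
  have hj := S.norm_coord_le_of_mem_cusp h hp
  have h10 := S.ten_le_bound
  have hv := S.coord_vietaMap_self j p
  rw [hprod] at hv
  have htri : ‖coord i p‖ * ‖coord k p‖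
      ≤ ‖coord j (S.vietaMap j p)‖ + ‖coord j p‖ + ‖S.coeff j‖ := by
    rw [← norm_mul, show coord i p * coord k p
      = -coord j (S.vietaMap j p) - coord j p + S.coeff j by rw [hv]; ring]
    refine (norm_add_le _ _).trans (add_le_add_left ((norm_sub_le _ _).trans ?_) _)
    rw [norm_neg]
  nlinarith

/-- The old and new `i`-th coordinates are the roots of a quadratic. With `u`, `v` the norms of the
other coordinates, Vieta bounds the product of the roots by `3u² + 2v²`; both points in the cusp
would force it to be at least `u²v²/9`. -/
theorem vietaMap_notMem_cusp (S : Fam) (i : Fin 3) {p : ℂ × ℂ × ℂ} (hpS : p ∈ S.points)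
    (hp : p ∈ S.cusp i) : S.vietaMap i p ∉ S.cusp i := by
  intro hp'
  obtain ⟨h1, h2, h3⟩ := hp
  have h3' := hp'.2.2
  have hne1 : i + 1 ≠ i := (by decide : ∀ i : Fin 3, i + 1 ≠ i) i
  have hne2 : i + 2 ≠ i := (by decide : ∀ i : Fin 3, i + 2 ≠ i) i
  rw [S.coord_vietaMap_of_ne hne1, S.coord_vietaMap_of_ne hne2] at h3'
  rw [S.mem_points_iff i] at hpS
  have hprod : coord i p * coord i (S.vietaMap i p)
      = coord (i + 1) p ^ 2 + coord (i + 2) p ^ 2 - S.coeff (i + 1) * coord (i + 1) p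
        - S.coeff (i + 2) * coord (i + 2) p - S.D := by
    rw [coord_vietaMap_self]
    linear_combination -hpS
  have hn : ‖coord i p‖ * ‖coord i (S.vietaMap i p)‖
      ≤ ‖coord (i + 1) p‖ ^ 2 + ‖coord (i + 2) p‖ ^ 2
        + ‖S.coeff (i + 1)‖ * ‖coord (i + 1) p‖ + ‖S.coeff (i + 2)‖ * ‖coord (i + 2) p‖
        + ‖S.D‖ := by
    simp only [← norm_mul, ← norm_pow]
    rw [hprod]
    refine (norm_sub_le _ _).trans (add_le_add_left ?_ _)
    refine (norm_sub_le _ _).trans (add_le_add_left ?_ _)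
    refine (norm_sub_le _ _).trans (add_le_add_left ?_ _)
    exact norm_add_le _ _
  have h10 := S.ten_le_bound
  have hc1 := S.norm_coeff_le (i + 1)
  have hc2 := S.norm_coeff_le (i + 2)
  have hD := S.norm_D_le
  generalize ‖coord (i + 1) p‖ = u at *
  generalize ‖coord (i + 2) p‖ = v at *
  have h4 : (u * v) * (u * v) ≤ 3 * ‖coord i p‖ * (3 * ‖coord i (S.vietaMap i p)‖) :=
    mul_le_mul h3 h3' (by nlinarith) (by positivity)
  have h5 : ‖S.coeff (i + 1)‖ * u ≤ u * u := mul_le_mul_of_nonneg_right (by linarith) (by linarith)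
  have h6 : ‖S.coeff (i + 2)‖ * v ≤ v * v := mul_le_mul_of_nonneg_right (by linarith) (by linarith)
  have h7 : ‖S.D‖ ≤ u * u := by nlinarith
  have hu : 100 ≤ u * u := by nlinarith
  have hv : 100 ≤ v * v := by nlinarith
  nlinarith [mul_le_mul_of_nonneg_right hu (by positivity : 0 ≤ v * v),
    mul_le_mul_of_nonneg_left hv (by positivity : 0 ≤ u * u)]

theorem norm_vietaMap_le (S : Fam) (i j : Fin 3) {p : ℂ × ℂ × ℂ} (hpS : p ∈ S.points)
    (hp : p ∈ S.cusp i) (hp' : S.vietaMap i p ∈ S.cusp j) :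
    ‖S.vietaMap i p‖ ≤ ‖p‖ - 1 := by
  have h : j ≠ i := by
    rintro rfl
    exact S.vietaMap_notMem_cusp j hpS hp hp'
  rw [S.norm_eq_of_mem_cusp hp, S.norm_eq_of_mem_cusp hp', S.coord_vietaMap_of_ne h]
  linarith [S.norm_coord_le_of_mem_cusp h.symm hp, S.bound_le_of_mem_cusp j hp, S.ten_le_bound]

/-- The radius of a ball outside which every point of the surface can be moved to a cusp. -/
noncomputable def radius (S : Fam) : ℝ := 7 * S.bound ^ 2

/-- The equation is monic quadratic in this coordinate, with the other coefficients bounded. -/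
theorem norm_coord_le_radius (S : Fam) {p : ℂ × ℂ × ℂ} (hpS : p ∈ S.points) (i : Fin 3)
    (h1 : ‖coord (i + 1) p‖ ≤ S.bound) (h2 : ‖coord (i + 2) p‖ ≤ S.bound) :
    ‖coord i p‖ ≤ S.radius := by
  rw [S.mem_points_iff i] at hpS
  have hsq : coord i p ^ 2 = S.coeff i * coord i p - coord i p * coord (i + 1) p * coord (i + 2) p
      + S.coeff (i + 1) * coord (i + 1) p + S.coeff (i + 2) * coord (i + 2) p + S.D
      - coord (i + 1) p ^ 2 - coord (i + 2) p ^ 2 := by linear_combination hpS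
  have hn : ‖coord i p‖ ^ 2 ≤ ‖S.coeff i‖ * ‖coord i p‖
      + ‖coord i p‖ * ‖coord (i + 1) p‖ * ‖coord (i + 2) p‖
      + ‖S.coeff (i + 1)‖ * ‖coord (i + 1) p‖ + ‖S.coeff (i + 2)‖ * ‖coord (i + 2) p‖
      + ‖S.D‖ + ‖coord (i + 1) p‖ ^ 2 + ‖coord (i + 2) p‖ ^ 2 := by
    simp only [← norm_mul, ← norm_pow]
    rw [hsq]
    refine (norm_sub_le _ _).trans (add_le_add_left ?_ _)
    refine (norm_sub_le _ _).trans (add_le_add_left ?_ _)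
    refine (norm_add_le _ _).trans (add_le_add_left ?_ _)
    refine (norm_add_le _ _).trans (add_le_add_left ?_ _)
    refine (norm_add_le _ _).trans (add_le_add_left ?_ _)
    exact norm_sub_le _ _
  have h10 := S.ten_le_bound
  have hc0 := S.norm_coeff_le i
  have hc1 := S.norm_coeff_le (i + 1)
  have hc2 := S.norm_coeff_le (i + 2)
  have hD := S.norm_D_le
  rw [radius]
  by_contra! hr
  generalize S.bound = K at *
  have hx := norm_nonneg (coord i p)
  have e0 : ‖S.coeff i‖ * ‖coord i p‖ ≤ K * ‖coord i p‖ := by gcongr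
  have e1 : ‖coord i p‖ * ‖coord (i + 1) p‖ * ‖coord (i + 2) p‖ ≤ ‖coord i p‖ * K * K := by gcongr
  have e2 : ‖S.coeff (i + 1)‖ * ‖coord (i + 1) p‖ ≤ K * K := by gcongr
  have e3 : ‖S.coeff (i + 2)‖ * ‖coord (i + 2) p‖ ≤ K * K := by gcongr
  have e4 : ‖coord (i + 1) p‖ ^ 2 ≤ K ^ 2 := by gcongr
  have e5 : ‖coord (i + 2) p‖ ^ 2 ≤ K ^ 2 := by gcongr
  generalize ‖coord i p‖ = x at *
  have hKK : K ≤ K ^ 2 := by nlinarith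
  have hx1 : 1 ≤ x := by nlinarith
  have e6 : K * x ≤ K ^ 2 * x := by gcongr
  have e7 : K ^ 2 * 1 ≤ K ^ 2 * x := by gcongr
  -- The terms bounding `x ^ 2` add up to at most seven copies of `K ^ 2 * x`, whence the 7 in
  -- `radius`.
  nlinarith [mul_lt_mul_of_pos_right hr (by linarith : 0 < x)]

/-- The two roots sum to a bounded coefficient minus the product of the other coordinates, so one of
them exceeds a third of that product in norm. -/
theorem mem_cusp_or_of_coord (S : Fam) {i : Fin 3} {p : ℂ × ℂ × ℂ}
    (h1 : S.bound ≤ ‖coord (i + 1) p‖) (h2 : S.bound ≤ ‖coord (i + 2) p‖) :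
    p ∈ S.cusp i ∨ S.vietaMap i p ∈ S.cusp i := by
  have hne1 : i + 1 ≠ i := (by decide : ∀ i : Fin 3, i + 1 ≠ i) i
  have hne2 : i + 2 ≠ i := (by decide : ∀ i : Fin 3, i + 2 ≠ i) i
  by_contra! h
  have ha : 3 * ‖coord i p‖ < ‖coord (i + 1) p‖ * ‖coord (i + 2) p‖ :=
    not_le.1 fun h3 => h.1 ⟨h1, h2, h3⟩
  have hb : 3 * ‖coord i (S.vietaMap i p)‖ < ‖coord (i + 1) p‖ * ‖coord (i + 2) p‖ := by
    refine not_le.1 fun h3 => h.2 ?_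
    rw [cusp, Set.mem_ofPred_eq, S.coord_vietaMap_of_ne hne1, S.coord_vietaMap_of_ne hne2]
    exact ⟨h1, h2, h3⟩
  have htri : ‖coord (i + 1) p‖ * ‖coord (i + 2) p‖
      ≤ ‖coord i (S.vietaMap i p)‖ + ‖coord i p‖ + ‖S.coeff i‖ := by
    rw [← norm_mul, show coord (i + 1) p * coord (i + 2) p
      = -coord i (S.vietaMap i p) - coord i p + S.coeff i by rw [coord_vietaMap_self]; ring]
    refine (norm_add_le _ _).trans (add_le_add_left ((norm_sub_le _ _).trans ?_) _)
    rw [norm_neg]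
  have := S.norm_coeff_le i
  have := S.ten_le_bound
  nlinarith

/-- Two large coordinates lead to a cusp; with at most one, the equation bounds the point. -/
theorem exists_mem_cusp (S : Fam) {p : ℂ × ℂ × ℂ} (hpS : p ∈ S.points) (hp : S.radius < ‖p‖) :
    ∃ i, p ∈ S.cusp i ∨ S.vietaMap i p ∈ S.cusp i := by
  by_contra! hcon
  have hsmall : ∀ i : Fin 3, ‖coord (i + 1) p‖ < S.bound ∨ ‖coord (i + 2) p‖ < S.bound := by
    intro i
    by_contra! h
    exact (S.mem_cusp_or_of_coord h.1 h.2).elim (hcon i).1 (hcon i).2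
  have hb : S.bound ≤ S.radius := by
    rw [radius]; nlinarith [S.ten_le_bound]
  refine hp.not_ge (norm_le_of_coord_le fun i => ?_)
  by_cases hi : ‖coord i p‖ < S.bound
  · linarith
  · have h3 : i + 1 + 2 = i ∧ i + 2 + 1 = i :=
      (by decide : ∀ i : Fin 3, i + 1 + 2 = i ∧ i + 2 + 1 = i) i
    have h1 := hsmall (i + 1)
    have h2 := hsmall (i + 2)
    rw [h3.1] at h1
    rw [h3.2] at h2
    have h4 : i + 1 + 1 = i + 2 :=
      (by decide : ∀ i : Fin 3, i + 1 + 1 = i + 2) i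
    have h5 : i + 2 + 2 = i + 1 :=
      (by decide : ∀ i : Fin 3, i + 2 + 2 = i + 1) i
    rw [h4] at h1
    rw [h5] at h2
    exact S.norm_coord_le_radius hpS i (h2.resolve_left hi).le (h1.resolve_right hi).le

end Fam

/-! ### Stationary measures on the product -/

theorem VietaGroup.gen_injective : Function.Injective VietaGroup.gen := by
  intro i j hij
  by_contra h
  -- The projection of the free product to its `i`-th factor kills the other generators.
  have := congrArg (Monoid.CoprodI.lift fun k : Fin 3 =>
    if k = i then MonoidHom.id (Multiplicative (ZMod 2)) else 1) hij
  rw [VietaGroup.gen, VietaGroup.gen, Monoid.CoprodI.lift_of, Monoid.CoprodI.lift_of, if_pos rfl,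
    if_neg (Ne.symm h)] at this
  exact absurd this (by decide)

/-- Stationarity for a measure `μ` supported by the generators is a finite sum. -/
theorem IsStationaryMeasure.eq_sum {X : Type*} [MeasurableSpace X] [SMul VietaGroup X]
    {μ : PMF VietaGroup} (hμ : μ.support = Set.range VietaGroup.gen) {ν : Measure X}
    (hν : IsStationaryMeasure μ ν) :
    ν = ∑ i, (μ (VietaGroup.gen i)).toNNReal • ν.map (fun x => VietaGroup.gen i • x) := by
  conv_lhs => rw [← hν]
  ext s hs
  rw [Measure.sum_apply _ hs, ← VietaGroup.gen_injective.tsum_eq, tsum_fintype,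
    Measure.finsetSum_apply]
  · refine Finset.sum_congr rfl fun i _ => ?_
    rw [Measure.smul_apply, Measure.smul_apply, ENNReal.smul_def,
      ENNReal.coe_toNNReal (μ.apply_ne_top _)]
  · intro g hg
    rw [← hμ, PMF.mem_support_iff]
    intro h
    simp [h] at hg

theorem sum_toNNReal_gen {μ : PMF VietaGroup} (hμ : μ.support = Set.range VietaGroup.gen) :
    ∑ i, (μ (VietaGroup.gen i)).toNNReal = 1 := by
  have h : ∑ i, μ (VietaGroup.gen i) = 1 := by
    rw [← μ.tsum_coe, ← tsum_fintype (L := .unconditional _)]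
    exact VietaGroup.gen_injective.tsum_eq (f := μ) hμ.subset
  rw [← ENNReal.toNNReal_sum fun i _ => μ.apply_ne_top _, h, ENNReal.toNNReal_one]

/-- Almost every point for a stationary measure has all its coordinates in the balls of
radius `Fam.radius`. -/
theorem measure_radius_lt_eq_zero {μ : PMF VietaGroup}
    (hμ : μ.support = Set.range VietaGroup.gen)
    {m : ℕ} {S : Fin m → Fam} {ν : Measure (∀ i, (S i).points)} [IsProbabilityMeasure ν]
    (hν : IsStationaryMeasure μ ν) (a : Fin m) :
    ν {x | (S a).radius < ‖(x a : ℂ × ℂ × ℂ)‖} = 0 := by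
  set t : Fin 3 → (∀ i, (S i).points) → ∀ i, (S i).points :=
    fun i x => VietaGroup.gen i • x with ht
  have htc : ∀ i x b, ((t i x b : (S b).points) : ℂ × ℂ × ℂ) = (S b).vietaMap i (x b) :=
    fun i x b => Fam.gen_smul (S b) i (x b)
  have htm : ∀ i, Measurable (t i) := fun i => by
    refine measurable_pi_lambda _ fun b => Measurable.subtype_mk (h := fun x => (t i x b).2) ?_
    simp only [htc]
    exact ((S b).continuous_vietaMap i).measurable.comp
      (measurable_subtype_coe.comp (measurable_pi_apply b))
  have htt : ∀ i x, t i (t i x) = x := fun i x => by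
    ext1 b
    exact Subtype.ext (by rw [htc, htc, Fam.vietaMap_vietaMap])
  set D : Fin 3 → Set (∀ i, (S i).points) :=
    fun i => {x | (x a : ℂ × ℂ × ℂ) ∈ (S a).cusp i} with hD
  have hDm : ∀ i, MeasurableSet (D i) := fun i =>
    (measurable_subtype_coe.comp (measurable_pi_apply a)) ((S a).isClosed_cusp i).measurableSet
  have hw : ∀ i, 0 < (μ (VietaGroup.gen i)).toNNReal := fun i =>
    ENNReal.toNNReal_pos ((PMF.mem_support_iff _ _).1 (hμ ▸ Set.mem_range_self i))
      (μ.apply_ne_top _)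
  have hsum := hν.eq_sum hμ
  have hzero : ∀ i, ν (D i) = 0 := by
    refine measure_eq_zero_of_pingPong (by simp) hw (sum_toNNReal_gen hμ) htm htt hsum hDm
      (fun i j x => (S a).cusp_disjoint i j _) (fun i j x hx hij => ?_)
      (fun x => ‖(x a : ℂ × ℂ × ℂ)‖) (fun x => norm_nonneg _) (fun i j x hx hx' => ?_)
    · change ((t j x a : (S a).points) : ℂ × ℂ × ℂ) ∈ (S a).cusp j
      rw [htc]
      exact (S a).vietaMap_mem_cusp i j _ hx hij
    · change ((t i x a : (S a).points) : ℂ × ℂ × ℂ) ∈ (S a).cusp j at hx'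
      rw [htc] at hx' ⊢
      exact (S a).norm_vietaMap_le i j (x a).2 hx hx'
  -- Stationarity writes `ν (D i) = 0` as a sum of nonnegative terms, one being a positive multiple
  -- of this measure.
  have hzero' : ∀ i, ν (t i ⁻¹' D i) = 0 := fun i => by
    have h := hzero i
    rw [hsum, Measure.finsetSum_apply, Finset.sum_eq_zero_iff] at h
    have h2 := h i (Finset.mem_univ i)
    rw [Measure.smul_apply, Measure.map_apply (htm i) (hDm i), ENNReal.smul_def, smul_eq_mul,
      mul_eq_zero] at h2
    exact h2.resolve_left (by exact_mod_cast (hw i).ne')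
  refine measure_mono_null (fun x hx => ?_) (measure_iUnion_null fun i =>
    measure_union_null (hzero i) (hzero' i))
  obtain ⟨i, hi⟩ := (S a).exists_mem_cusp (x a).2 hx
  refine Set.mem_iUnion.2 ⟨i, hi.imp id fun h => ?_⟩
  change ((t i x a : (S a).points) : ℂ × ℂ × ℂ) ∈ (S a).cusp i
  rwa [htc]

theorem mainTheorem8 (μ : PMF VietaGroup) (hμ : μ.support = Set.range VietaGroup.gen)
    (m : ℕ) (S : Fin m → Fam) (ν : Measure (∀ i, (S i).points)) [IsProbabilityMeasure ν]
    (hν : IsStationaryMeasure μ ν) :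
    IsCompact ν.support := by
  set B : ∀ i, Set (S i).points := fun i => {p | ‖(p : ℂ × ℂ × ℂ)‖ ≤ (S i).radius} with hB
  have hBc : ∀ i, IsCompact (B i) := fun i => by
    have h := (S i).isClosed_points.isClosedEmbedding_subtypeVal.isCompact_preimage
      (isCompact_closedBall (0 : ℂ × ℂ × ℂ) (S i).radius)
    convert h using 1
    ext p
    simp [hB]
  have hc : IsCompact (Set.univ.pi B) := isCompact_univ_pi hBc
  refine hc.of_isClosed_subset Measure.isClosed_support
    (Measure.support_subset_of_isClosed hc.isClosed ?_)
  rw [mem_ae_iff]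
  refine measure_mono_null (fun x hx => ?_)
    (measure_iUnion_null fun a => measure_radius_lt_eq_zero hμ hν a)
  simp only [Set.mem_compl_iff, Set.mem_univ_pi, not_forall] at hx
  obtain ⟨a, ha⟩ := hx
  exact Set.mem_iUnion.2 ⟨a, lt_of_not_ge (α := ℝ) ha⟩
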